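/- Let $m,n\ge 1$ be integers. For $\mathbf z=(z_1,\dots,z_k)\in\mathbb R^k$ put $$\Pi(\mathbf z)=\prod_{i=1}^k|z_i|^{1/k},\qquad \Pi'(\mathbf z)=\prod_{i=1}^k\max(1,|z_i|)^{1/k}.$$ For a real $n\times m$ matrix $\Theta$, the (regular) multiplicative Diophantine exponent $\omega_\times(\Theta)\in[0,+\infty]$ is the supremum of the real numbers $\gamma$ such that there exist arbitrarily large $t$ for which the system $$\Pi'(\mathbf x)\le t,\qquad \Pi(\Theta\mathbf x-\mathbf y)\le t^{-\gamma}$$ has a solution $\mathbf x\in\mathbb Z^m$, $\mathbf y\in\mathbb Z^n$ with $\mathbf x\ne\mathbf 0$. Let ${}^{\top}\Theta$ denote the transpose of $\Theta$; its exponent $\omega_\times({}^{\top}\Theta)$ is defined in the same way, with the roles of $m$ and $n$ interchanged. Then, for every $\Theta\in\mathbb R^{n\times m}$, $$\omega_\times({}^{\top}\Theta)\ \ge\ \frac{n\,\omega_\times(\Theta)+n-1}{(m-1)\,\omega_\times(\Theta)+m},$$ where for $\omega_\times(\Theta)=+\infty$ the right-hand side is understood as its limit, i.e. $+\infty$ if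 $m=1$ and $n/(m-1)$ if $m\ge2$. -/

import Mathlib

/-- The geometric mean `Π(z) = ∏ |z_i|^{1/k}` of the absolute values of the coordinates of
`z ∈ ℝ^k`. -/
noncomputable def geomProd {k : ℕ} (z : Fin k → ℝ) : ℝ :=
  ∏ i, |z i| ^ (1 / (k : ℝ))

/-- The truncated version `Π'(z) = ∏ max(1, |z_i|)^{1/k}` of `geomProd`. -/
noncomputable def geomProdTrunc {k : ℕ} (z : Fin k → ℝ) : ℝ :=
  ∏ i, (max 1 |z i|) ^ (1 / (k : ℝ))

/-- The system `Π'(x) ≤ t`, `Π(Θ x - y) ≤ t^{-γ}` has a solution in integer vectors `x ∈ ℤ^m`,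
`y ∈ ℤ^n` with `x ≠ 0`. -/
def MultSolvable {n m : ℕ} (Θ : Matrix (Fin n) (Fin m) ℝ) (γ t : ℝ) : Prop :=
  ∃ (x : Fin m → ℤ) (y : Fin n → ℤ), x ≠ 0 ∧
    geomProdTrunc (fun j => (x j : ℝ)) ≤ t ∧
    geomProd (fun i => Θ.mulVec (fun j => (x j : ℝ)) i - (y i : ℝ)) ≤ t ^ (-γ)

/-- The regular multiplicative Diophantine exponent `ω_×(Θ) ∈ [-∞, +∞]` of an `n × m` matrix `Θ`:
the supremum of the real `γ` for which the system is solvable for arbitrarily large `t`. -/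
noncomputable def multExponent {n m : ℕ} (Θ : Matrix (Fin n) (Fin m) ℝ) : EReal :=
  sSup {w : EReal | ∃ γ : ℝ, w = (γ : EReal) ∧ ∀ t₀ : ℝ, ∃ t : ℝ, t₀ < t ∧ MultSolvable Θ γ t}

/-- The fraction `(n w + n - 1) / ((m - 1) w + m)`, extended to `w = +∞` by its limit there, which
is `+∞` for `m = 1` and `n / (m - 1)` for `m ≥ 2`. (The value at `w = -∞` plays no role, since
exponents are nonnegative.) -/
noncomputable def dysonFraction (n m : ℕ) (w : EReal) : EReal :=
  if w = ⊤ then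
    if m = 1 then ⊤ else (((n : ℝ) / ((m : ℝ) - 1) : ℝ) : EReal)
  else
    ((((n : ℝ) * w.toReal + (n : ℝ) - 1) / (((m : ℝ) - 1) * w.toReal + (m : ℝ)) : ℝ) : EReal)

/-! The transference is carried by `exists_transpose_solution`. Given a good approximation `(x, y)`
with errors `δ = Θx - y`, fix `k` with `x k ≠ 0` and seek `(u, w)` with all `L j = (Θᵀu + w) j`
small. Minkowski's theorem is applied to the `u i`, the `L j` with `j ≠ k`, and the integer form
`y·u + x·w`, bounded by 1 and hence zero. Then `x·L = u·δ`, which bounds the missing `L k`, provided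
each `u i * δ i` is small; `exists_bounds_prod_eq` shapes the box in `u` accordingly. Optimising the
box gives the fraction, and Dirichlet's theorem covers targets below `n / m`. -/

/-- Minkowski's theorem on linear forms, with strict inequalities. -/
theorem exists_int_ne_zero_forall_abs_mulVec_lt {ι : Type*} [Fintype ι] [DecidableEq ι]
    (A : Matrix ι ι ℝ) (hA : A.det ≠ 0) (c : ι → ℝ) (hc : ∀ i, 0 < c i)
    (hdet : |A.det| < ∏ i, c i) :
    ∃ z : ι → ℤ, z ≠ 0 ∧ ∀ i, |A.mulVec (fun j => (z j : ℝ)) i| < c i := by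
  classical
  let f : (ι → ℝ) →ₗ[ℝ] (ι → ℝ) := Matrix.toLin' A
  have hf : LinearMap.det f = A.det := LinearMap.det_toLin' A
  let box : Set (ι → ℝ) := Set.pi Set.univ fun i => Set.Ioo (-c i) (c i)
  have hmem : ∀ x, x ∈ f ⁻¹' box ↔ ∀ i, |A.mulVec x i| < c i := by
    intro x
    simp [f, box, Set.mem_pi, abs_lt]
  have hfund := ZSpan.isAddFundamentalDomain' (Pi.basisFun ℝ ι) MeasureTheory.volume
  have hconv : Convex ℝ (f ⁻¹' box) :=
    (convex_pi fun i _ => convex_Ioo _ _).linear_preimage f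
  have hsymm : ∀ x ∈ f ⁻¹' box, -x ∈ f ⁻¹' box := by
    intro x hx
    rw [hmem] at hx ⊢
    intro i
    rw [Matrix.mulVec_neg, Pi.neg_apply, abs_neg]
    exact hx i
  have hvol : MeasureTheory.volume (ZSpan.fundamentalDomain (Pi.basisFun ℝ ι)) *
      2 ^ Module.finrank ℝ (ι → ℝ) < MeasureTheory.volume (f ⁻¹' box) := by
    rw [MeasureTheory.Measure.addHaar_preimage_linearMap _ (by rw [hf]; exact hA), hf,
      MeasureTheory.volume_pi_pi, ZSpan.fundamentalDomain_pi_basisFun,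
      MeasureTheory.volume_pi_pi]
    simp only [Real.volume_Ico, Real.volume_Ioo, sub_zero, ENNReal.ofReal_one,
      Finset.prod_const_one, one_mul, Module.finrank_fintype_fun_eq_card]
    rw [← ENNReal.ofReal_prod_of_nonneg (fun i _ => by linarith [hc i]),
      ← ENNReal.ofReal_mul (abs_nonneg _)]
    have h2 : (2 : ENNReal) ^ Fintype.card ι = ENNReal.ofReal (2 ^ Fintype.card ι) := by
      rw [ENNReal.ofReal_pow (by norm_num)]; norm_num
    rw [h2, ENNReal.ofReal_lt_ofReal_iff_of_nonneg (by positivity)]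
    have h3 : ∏ i, (c i - -c i) = 2 ^ Fintype.card ι * ∏ i, c i := by
      simp only [sub_neg_eq_add, ← two_mul, Finset.prod_mul_distrib, Finset.prod_const,
        Finset.card_univ]
    rw [h3, abs_inv, inv_mul_eq_div, lt_div_iff₀ (abs_pos.2 hA)]
    exact mul_lt_mul_of_pos_left hdet (by positivity)
  have : Countable (Submodule.span ℤ (Set.range (Pi.basisFun ℝ ι))).toAddSubgroup :=
    inferInstanceAs (Countable (Submodule.span ℤ (Set.range (Pi.basisFun ℝ ι))))
  obtain ⟨x, hx0, hx⟩ :=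
    MeasureTheory.exists_ne_zero_mem_lattice_of_measure_mul_two_pow_lt_measure hfund hsymm hconv
      hvol
  have hint : ∀ i, ∃ a : ℤ, (a : ℝ) = (x : ι → ℝ) i := by
    intro i
    have := ((Pi.basisFun ℝ ι).mem_span_iff_repr_mem ℤ (x : ι → ℝ)).mp x.2 i
    simpa using this
  choose z hz using hint
  have hzx : (fun j => (z j : ℝ)) = (x : ι → ℝ) := funext hz
  refine ⟨z, ?_, ?_⟩
  · rintro rfl
    apply hx0
    apply Subtype.ext
    rw [← hzx]
    ext
    simp
  · rw [hzx]
    exact (hmem _).1 hx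

/-- Minkowski's theorem for the forms `u i` and `(C u + D w) j`. -/
theorem exists_int_block_forms {ι κ : Type*} [Fintype ι] [Fintype κ] [DecidableEq ι]
    [DecidableEq κ] (C : Matrix κ ι ℝ) (D : Matrix κ κ ℝ) (hD : D.det ≠ 0)
    (b : ι → ℝ) (c : κ → ℝ) (hb : ∀ i, 0 < b i) (hc : ∀ j, 0 < c j)
    (hdet : |D.det| < (∏ i, b i) * ∏ j, c j) :
    ∃ (u : ι → ℤ) (w : κ → ℤ), (u ≠ 0 ∨ w ≠ 0) ∧ (∀ i, |(u i : ℝ)| < b i) ∧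
      ∀ j, |C.mulVec (fun i => (u i : ℝ)) j + D.mulVec (fun j => (w j : ℝ)) j| < c j := by
  have hdet' : (Matrix.fromBlocks 1 0 C D).det = D.det := by
    rw [Matrix.det_fromBlocks_zero₁₂, Matrix.det_one, one_mul]
  obtain ⟨z, hz0, hz⟩ := exists_int_ne_zero_forall_abs_mulVec_lt (Matrix.fromBlocks 1 0 C D)
    (by rwa [hdet']) (Sum.elim b c) (by rintro (i | j) <;> simp [hb, hc])
    (by rw [hdet', Fintype.prod_sum_type]; simpa using hdet)
  simp only [Matrix.fromBlocks_mulVec] at hz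
  refine ⟨fun i => z (Sum.inl i), fun j => z (Sum.inr j), ?_, fun i => ?_, fun j => ?_⟩
  · by_contra! h
    apply hz0
    ext (i | j)
    · exact congrFun h.1 i
    · exact congrFun h.2 j
  · have := hz (Sum.inl i)
    simpa [Function.comp_def] using this
  · have := hz (Sum.inr j)
    simpa [Function.comp_def] using this

/-! ### Transference from one integer point -/

/-- Greedy choice: each coordinate takes 1 if `K ≤ δ a`, all of the remaining `Q` if that is
allowed, and `K / δ a` otherwise. The alternative `B i = 1` is harmless because an integer of
absolute value below 1 vanishes. -/
theorem exists_bounds_prod_eq {ι : Type*} [DecidableEq ι] (δ : ι → ℝ) (hδ : ∀ i, 0 ≤ δ i)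
    {K : ℝ} (hK : 0 < K) (s : Finset ι) :
    ∀ Q : ℝ, 1 ≤ Q → (∏ i ∈ s, δ i) * Q ≤ K ^ s.card →
      ∃ B : ι → ℝ, (∀ i, 1 ≤ B i) ∧ (∀ i, B i = 1 ∨ B i * δ i ≤ K) ∧ ∏ i ∈ s, B i = Q := by
  induction s using Finset.induction_on with
  | empty =>
    intro Q hQ h
    exact ⟨fun _ => 1, fun _ => le_rfl, fun _ => Or.inl rfl, by
      simp at h ⊢; linarith⟩
  | insert a s ha ih =>
    intro Q hQ h
    rw [Finset.prod_insert ha, Finset.card_insert_of_notMem ha, pow_succ] at h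
    have hP : 0 ≤ ∏ i ∈ s, δ i := Finset.prod_nonneg fun i _ => hδ i
    have key : ∀ b : ℝ, 1 ≤ b → b ≤ Q → (b = 1 ∨ b * δ a ≤ K) →
        (∏ i ∈ s, δ i) * (Q / b) ≤ K ^ s.card → ∃ B : ι → ℝ, (∀ i, 1 ≤ B i) ∧
          (∀ i, B i = 1 ∨ B i * δ i ≤ K) ∧ ∏ i ∈ insert a s, B i = Q := by
      intro b hb hbQ hbK hle
      obtain ⟨B, h1, h2, h3⟩ := ih (Q / b) ((one_le_div (by linarith)).2 hbQ) hle
      refine ⟨Function.update B a b, fun i => ?_, fun i => ?_, ?_⟩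
      · by_cases hi : i = a
        · subst hi; simpa using hb
        · simpa [hi] using h1 i
      · by_cases hi : i = a
        · subst hi; simpa using hbK
        · simpa [hi] using h2 i
      · rw [Finset.prod_insert ha, Finset.prod_update_of_notMem ha, h3, Function.update_self]
        field_simp
    by_cases h1 : K ≤ δ a
    · refine key 1 le_rfl hQ (Or.inl rfl) ?_
      rw [div_one]
      refine le_of_mul_le_mul_right ?_ hK
      calc (∏ i ∈ s, δ i) * Q * K ≤ (∏ i ∈ s, δ i) * Q * δ a :=
            mul_le_mul_of_nonneg_left h1 (by positivity)
        _ = δ a * (∏ i ∈ s, δ i) * Q := by ring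
        _ ≤ _ := h
    push Not at h1
    by_cases h2 : δ a * Q ≤ K
    · refine ⟨Function.update 1 a Q, fun i => ?_, fun i => ?_, ?_⟩
      · by_cases hi : i = a
        · subst hi; simpa using hQ
        · simp [hi]
      · by_cases hi : i = a
        · subst hi; exact Or.inr (by simpa [mul_comm] using h2)
        · simp [hi]
      · rw [Finset.prod_insert ha, Finset.prod_update_of_notMem ha]
        simp
    · push Not at h2
      have ha0 : 0 < δ a := by
        by_contra! h0
        have : δ a = 0 := le_antisymm h0 (hδ a)
        rw [this] at h2; linarith
      refine key (K / δ a) ((one_le_div ha0).2 h1.le) ((div_le_iff₀ ha0).2 (by linarith))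
        (Or.inr (by field_simp; exact le_rfl)) ?_
      rw [div_div_eq_mul_div, ← mul_div_assoc, div_le_iff₀ hK]
      linarith

theorem updateRow_mulVec_self {ι κ : Type*} [Fintype ι] [DecidableEq κ]
    (A : Matrix κ ι ℝ) (k : κ) (r v : ι → ℝ) : (A.updateRow k r).mulVec v k = r ⬝ᵥ v := by
  simp [Matrix.mulVec]

theorem updateRow_mulVec_of_ne {ι κ : Type*} [Fintype ι] [DecidableEq κ]
    (A : Matrix κ ι ℝ) {k j : κ} (h : j ≠ k) (r v : ι → ℝ) :
    (A.updateRow k r).mulVec v j = A.mulVec v j := by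
  simp only [Matrix.mulVec, dotProduct, Matrix.updateRow_ne h]

theorem det_updateRow_one {κ : Type*} [Fintype κ] [DecidableEq κ] (k : κ) (r : κ → ℝ) :
    ((1 : Matrix κ κ ℝ).updateRow k r).det = r k := by
  rw [← Matrix.cramer_transpose_apply, Matrix.transpose_one, Matrix.cramer_one]
  rfl

theorem abs_dotProduct_le {ι : Type*} [Fintype ι] (a b : ι → ℝ) (K : ℝ)
    (h : ∀ i, |a i * b i| ≤ K) : |a ⬝ᵥ b| ≤ Fintype.card ι * K := by
  refine (Finset.abs_sum_le_sum_abs _ _).trans ((Finset.sum_le_sum fun i _ => h i).trans ?_)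
  simp

/-- From one integer point `(x, y)` one gets an integer point of the transposed system. -/
theorem exists_transpose_solution {n m : ℕ} (Θ : Matrix (Fin n) (Fin m) ℝ) (x : Fin m → ℤ)
    (y : Fin n → ℤ) (hx : x ≠ 0) {K Q : ℝ} (hK : 0 < K) (hK1 : ((n : ℝ) + m) * K < 1)
    (hQ : 1 ≤ Q) (hXQ : (∏ j, max 1 |(x j : ℝ)|) * K < Q * K ^ m)
    (hδ : (∏ i, |Θ.mulVec (fun j => (x j : ℝ)) i - y i|) * Q ≤ K ^ n) :
    ∃ (u : Fin n → ℤ) (w : Fin m → ℤ), u ≠ 0 ∧ ∏ i, max 1 |(u i : ℝ)| ≤ Q ∧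
      ∏ j, |Θ.transpose.mulVec (fun i => (u i : ℝ)) j - w j| ≤
        (((n : ℝ) + m) * K) ^ m / ∏ j, max 1 |(x j : ℝ)| := by
  obtain ⟨k, hk⟩ := Function.ne_iff.1 hx
  set xr : Fin m → ℝ := fun j => (x j : ℝ) with hxr
  set yr : Fin n → ℝ := fun i => (y i : ℝ) with hyr
  set X : Fin m → ℝ := fun j => max 1 |(x j : ℝ)| with hX
  set δ : Fin n → ℝ := fun i => Θ.mulVec xr i - yr i with hδdef
  have hX1 : ∀ j, 1 ≤ X j := fun j => le_max_left _ _
  have hX0 : ∀ j, 0 < X j := fun j => by linarith [hX1 j]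
  have hxX : ∀ j, |xr j| ≤ X j := fun j => le_max_right _ _
  have hxk1 : 1 ≤ |xr k| := by
    have : (1 : ℤ) ≤ |x k| := Int.one_le_abs hk
    simp only [hxr]
    exact_mod_cast this
  have hXk : X k = |xr k| := max_eq_right hxk1
  obtain ⟨B, hB1, hBδ, hBQ⟩ := exists_bounds_prod_eq (fun i => |δ i|) (fun i => abs_nonneg _) hK
    Finset.univ Q hQ (by simpa using hδ)
  have hPX : 0 < ∏ j, X j := Finset.prod_pos fun j _ => hX0 j
  -- Row `k` is replaced by `y·u + x·w`, so the determinant is `x k`; its absolute value `X k` makes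
  -- up for the missing factor `K / X k`.
  obtain ⟨u, w, huw, hu, hL⟩ := exists_int_block_forms (Θ.transpose.updateRow k yr)
    ((1 : Matrix (Fin m) (Fin m) ℝ).updateRow k xr)
    (by rw [det_updateRow_one]; intro h; rw [h, abs_zero] at hxk1; linarith)
    B (Function.update (fun j => K / X j) k 1) (fun i => by linarith [hB1 i])
    (fun j => by
      by_cases hj : j = k
      · subst hj; simp
      · simpa [hj] using div_pos hK (hX0 j))
    (by
      rw [det_updateRow_one, hBQ, Finset.prod_update_of_mem (Finset.mem_univ k), one_mul, ← hXk]
      have h1 : ∏ j, K / X j = K ^ m / ∏ j, X j := by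
        rw [Finset.prod_div_distrib]; simp
      rw [Finset.prod_eq_mul_prod_sdiff_singleton_of_mem (Finset.mem_univ k)] at h1
      have hXk0 := hX0 k
      set R := ∏ j ∈ Finset.univ \ {k}, K / X j
      rw [eq_div_iff hPX.ne'] at h1
      rw [← mul_lt_mul_iff_left₀ (mul_pos hK hPX)]
      calc X k * (K * ∏ j, X j) = X k * ((∏ j, X j) * K) := by ring
        _ < X k * (Q * K ^ m) := mul_lt_mul_of_pos_left hXQ hXk0
        _ = Q * R * (K * ∏ j, X j) := by rw [← h1]; field_simp)
  set ur : Fin n → ℝ := fun i => (u i : ℝ) with hur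
  set wr : Fin m → ℝ := fun j => (w j : ℝ) with hwr
  set L : Fin m → ℝ := Θ.transpose.mulVec ur + wr with hLdef
  have hdual : yr ⬝ᵥ ur + xr ⬝ᵥ wr = 0 := by
    have h1 := hL k
    rw [updateRow_mulVec_self, updateRow_mulVec_self, Function.update_self] at h1
    have h2 : yr ⬝ᵥ ur + xr ⬝ᵥ wr = ((∑ i, y i * u i + ∑ j, x j * w j : ℤ) : ℝ) := by
      simp [dotProduct, hxr, hyr, hur, hwr]
    rw [h2] at h1 ⊢
    have h3 : |(∑ i, y i * u i + ∑ j, x j * w j : ℤ)| < 1 := by exact_mod_cast h1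
    rw [Int.abs_lt_one_iff.1 h3, Int.cast_zero]
  have hLne : ∀ j, j ≠ k → |xr j * L j| ≤ K := by
    intro j hj
    have h1 := hL j
    rw [updateRow_mulVec_of_ne _ hj, updateRow_mulVec_of_ne _ hj, Matrix.one_mulVec,
      Function.update_of_ne hj] at h1
    have h2 : |L j| ≤ K / X j := h1.le
    rw [abs_mul]
    calc |xr j| * |L j| ≤ X j * (K / X j) := by
          gcongr
          exact hxX j
      _ = K := by field_simp [(hX0 j).ne']
  have hudelta : ∀ i, |ur i * δ i| ≤ K := by
    intro i
    rw [abs_mul]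
    rcases hBδ i with h | h
    · have h1 := hu i
      rw [h] at h1
      have h2 : |u i| < 1 := by exact_mod_cast h1
      have h3 : ur i = 0 := by simp [hur, Int.abs_lt_one_iff.1 h2]
      rw [h3]; simpa using hK.le
    · exact (mul_le_mul_of_nonneg_right (hu i).le (abs_nonneg _)).trans h
  have hpair : xr ⬝ᵥ L = ur ⬝ᵥ δ := by
    have h1 : xr ⬝ᵥ Θ.transpose.mulVec ur = ur ⬝ᵥ Θ.mulVec xr := by
      rw [Matrix.mulVec_transpose, dotProduct_comm, Matrix.dotProduct_mulVec]
    have h2 : δ = Θ.mulVec xr - yr := rfl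
    rw [hLdef, dotProduct_add, h1, h2, dotProduct_sub]
    rw [dotProduct_comm yr ur] at hdual
    linarith
  have hLall : ∀ j, |L j| ≤ ((n : ℝ) + m) * K / X j := by
    intro j
    rw [le_div_iff₀ (hX0 j)]
    have hm : (1 : ℝ) ≤ m := by exact_mod_cast Fin.pos k
    by_cases hj : j = k
    -- Solve `x·L = u·δ` for `x j * L j`: the right side has `n` terms and the rest of the left side
    -- at most `m`, each at most `K`.
    · subst hj
      have h1 := abs_dotProduct_le ur δ K hudelta
      have h2 := abs_dotProduct_le (Function.update xr j 0) L K (fun i => by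
        by_cases hi : i = j
        · subst hi; simpa using hK.le
        · simpa [hi] using hLne i hi)
      have h3 : xr ⬝ᵥ L = xr j * L j + Function.update xr j 0 ⬝ᵥ L := by
        simp only [dotProduct]
        rw [Finset.sum_eq_add_sum_sdiff_singleton_of_mem (Finset.mem_univ j),
          Finset.sum_eq_add_sum_sdiff_singleton_of_mem (Finset.mem_univ j)
            (fun i => Function.update xr j 0 i * L i), Function.update_self, zero_mul, zero_add]
        congr 1
        refine Finset.sum_congr rfl fun i hi => ?_
        rw [Function.update_of_ne (by simpa using hi)]
      rw [Fintype.card_fin] at h1 h2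
      have h4 : xr j * L j = ur ⬝ᵥ δ - Function.update xr j 0 ⬝ᵥ L := by
        rw [← hpair, h3]; ring
      rw [hXk, mul_comm, ← abs_mul, h4]
      refine (abs_sub _ _).trans ?_
      linarith
    · have h1 := hL j
      rw [updateRow_mulVec_of_ne _ hj, updateRow_mulVec_of_ne _ hj, Matrix.one_mulVec,
        Function.update_of_ne hj, lt_div_iff₀ (hX0 j)] at h1
      have h2 : |L j| * X j < K := h1
      nlinarith [Nat.cast_nonneg (α := ℝ) n]
  refine ⟨u, -w, ?_, ?_, ?_⟩
  -- If `u = 0`, then `L = w` has all entries below 1, so `w = 0` as well.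
  · intro hu0
    apply huw.elim (fun h => h hu0)
    intro hw
    apply hw
    ext j
    have h1 := hLall j
    have h2 : L j = wr j := by
      have : ur = 0 := by rw [hur, hu0]; ext; simp
      rw [hLdef, this]; simp
    rw [h2] at h1
    have h3 : |wr j| < 1 := by
      refine h1.trans_lt ((div_lt_one (hX0 j)).2 ?_)
      linarith [hX1 j]
    have h4 : |w j| < 1 := by simp only [hwr] at h3; exact_mod_cast h3
    simpa using Int.abs_lt_one_iff.1 h4
  · rw [← hBQ]
    exact Finset.prod_le_prod (fun i _ => by positivity) fun i _ => max_le (hB1 i) (hu i).le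
  · have h1 : ∀ j, Θ.transpose.mulVec ur j - ((-w) j : ℤ) = L j := by
      intro j; simp [hLdef, hwr]
    rw [Finset.prod_congr rfl fun j _ => congrArg abs (h1 j)]
    calc ∏ j, |L j| ≤ ∏ j, ((n : ℝ) + m) * K / X j :=
          Finset.prod_le_prod (fun j _ => abs_nonneg _) fun j _ => hLall j
      _ = _ := by rw [Finset.prod_div_distrib]; simp

/-! ### Systems without roots, and the Dirichlet bound -/

open Real in
theorem prod_rpow_one_div_le_iff {k : ℕ} (hk : k ≠ 0) (a : Fin k → ℝ) (ha : ∀ i, 0 ≤ a i)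
    {T : ℝ} (hT : 0 ≤ T) : ∏ i, a i ^ (1 / (k : ℝ)) ≤ T ↔ ∏ i, a i ≤ T ^ k := by
  have h : (∏ i, a i ^ (1 / (k : ℝ))) ^ k = ∏ i, a i := by
    rw [← Finset.prod_pow]
    refine Finset.prod_congr rfl fun i _ => ?_
    rw [one_div, rpow_inv_natCast_pow (ha i) hk]
  rw [← h, pow_le_pow_iff_left₀ (Finset.prod_nonneg fun i _ => rpow_nonneg (ha i) _) hT hk]

theorem multSolvable_iff {n m : ℕ} (hn : n ≠ 0) (hm : m ≠ 0) (Θ : Matrix (Fin n) (Fin m) ℝ)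
    (γ : ℝ) {t : ℝ} (ht : 0 < t) : MultSolvable Θ γ t ↔
      ∃ (x : Fin m → ℤ) (y : Fin n → ℤ), x ≠ 0 ∧ ∏ j, max 1 |(x j : ℝ)| ≤ t ^ m ∧
        ∏ i, |Θ.mulVec (fun j => (x j : ℝ)) i - y i| ≤ (t ^ (-γ)) ^ n := by
  simp only [MultSolvable, geomProdTrunc, geomProd]
  refine exists_congr fun x => exists_congr fun y => and_congr_right fun _ => and_congr ?_ ?_
  · exact prod_rpow_one_div_le_iff hm _ (fun _ => by positivity) ht.le
  · exact prod_rpow_one_div_le_iff hn _ (fun _ => abs_nonneg _) (by positivity)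

/-- Dirichlet's theorem for systems of linear forms. -/
theorem multSolvable_of_lt_div {n m : ℕ} (hn : n ≠ 0) (hm : m ≠ 0)
    (Θ : Matrix (Fin n) (Fin m) ℝ) {γ t : ℝ} (hγ : 0 ≤ γ) (hγm : γ < m / n) (ht : 1 < t) :
    MultSolvable Θ γ t := by
  have ht0 : 0 < t := by linarith
  have hn0 : (0 : ℝ) < n := by positivity
  rw [multSolvable_iff hn hm _ _ ht0]
  have hε : 0 < t ^ (-γ) := Real.rpow_pos_of_pos ht0 _
  obtain ⟨u, w, huw, hu, hw⟩ := exists_int_block_forms Θ 1 (by simp) (fun _ => t)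
    (fun _ => t ^ (-γ)) (fun _ => ht0) (fun _ => hε) (by
      rw [Matrix.det_one, abs_one, Finset.prod_const, Finset.prod_const, Finset.card_univ,
        Finset.card_univ, Fintype.card_fin, Fintype.card_fin, ← Real.rpow_natCast,
        ← Real.rpow_natCast, ← Real.rpow_mul ht0.le, ← Real.rpow_add ht0]
      apply Real.one_lt_rpow ht
      rw [lt_div_iff₀ hn0] at hγm
      linarith)
  simp only [Matrix.one_mulVec] at hw
  refine ⟨u, -w, ?_, ?_, ?_⟩
  · rintro rfl
    refine huw.elim (fun h => h rfl) fun hw0 => hw0 ?_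
    ext j
    have h1 := hw j
    have h2 : Θ.mulVec (fun j => (((0 : Fin m → ℤ) j : ℤ) : ℝ)) j = 0 := by
      simp [Matrix.mulVec, dotProduct]
    rw [h2, zero_add] at h1
    have h3 : |(w j : ℝ)| < 1 :=
      h1.trans_le (Real.rpow_le_one_of_one_le_of_nonpos ht.le (by linarith))
    have h4 : |w j| < 1 := by exact_mod_cast h3
    exact Int.abs_lt_one_iff.1 h4
  · calc ∏ j, max 1 |(u j : ℝ)| ≤ ∏ _j : Fin m, t :=
          Finset.prod_le_prod (fun j _ => by positivity) fun j _ => max_le ht.le (hu j).le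
      _ = t ^ m := by simp
  · calc ∏ i, |Θ.mulVec (fun j => (u j : ℝ)) i - ((-w) i : ℤ)| ≤ ∏ _i : Fin n, t ^ (-γ) :=
          Finset.prod_le_prod (fun j _ => abs_nonneg _) fun j _ => by
            simpa using (hw j).le
      _ = _ := by simp

theorem le_multExponent_of_frequently {n m : ℕ} {Θ : Matrix (Fin n) (Fin m) ℝ} {γ : ℝ}
    (h : ∀ t₀ : ℝ, ∃ t : ℝ, t₀ < t ∧ MultSolvable Θ γ t) : (γ : EReal) ≤ multExponent Θ :=
  le_sSup ⟨γ, rfl, h⟩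

theorem div_le_multExponent {n m : ℕ} (hn : n ≠ 0) (hm : m ≠ 0)
    (Θ : Matrix (Fin n) (Fin m) ℝ) : (((m : ℝ) / n : ℝ) : EReal) ≤ multExponent Θ := by
  refine EReal.ge_of_forall_gt_iff_ge.1 fun z hz => ?_
  have hz' : z < m / n := by exact_mod_cast hz
  have hmn : (0 : ℝ) < m / n := by positivity
  refine le_trans (b := ((max z 0 : ℝ) : EReal)) (by exact_mod_cast le_max_left _ _) ?_
  refine le_multExponent_of_frequently fun t₀ => ⟨max t₀ 1 + 1, ?_, ?_⟩
  · linarith [le_max_left t₀ 1]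
  · exact multSolvable_of_lt_div hn hm Θ (le_max_right _ _) (max_lt hz' hmn)
      (by linarith [le_max_right t₀ 1])

-- On a logarithmic scale every constraint is linear. The last strict hypothesis absorbs the
-- constants once `t` is large, and `m < n * γ` forces `K → 0`.
open Real in
theorem frequently_multSolvable_transpose {n m : ℕ} (hn : n ≠ 0) (hm : m ≠ 0)
    (Θ : Matrix (Fin n) (Fin m) ℝ) {γ c : ℝ} (hc : (n : ℝ) ≤ c * m) (hγ : (m : ℝ) < n * γ)
    (hcγ : c * m - n + 1 < γ * (n - c * (m - 1)))
    (h : ∀ t₀ : ℝ, ∃ t : ℝ, t₀ < t ∧ MultSolvable Θ γ t) (T₀ : ℝ) :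
    ∃ T : ℝ, T₀ < T ∧ MultSolvable Θ.transpose c T := by
  have hn1 : (1 : ℝ) ≤ n := by exact_mod_cast Nat.one_le_iff_ne_zero.2 hn
  have hm1 : (1 : ℝ) ≤ m := by exact_mod_cast Nat.one_le_iff_ne_zero.2 hm
  have hc0 : 0 < c := by
    by_contra! h0
    nlinarith
  have hγ0 : 0 < γ := by
    by_contra! h0
    nlinarith
  set N : ℝ := n + m - 1 with hN
  have hN1 : 1 ≤ N := by linarith
  set l : ℝ := log (n + m) with hl
  have hl0 : 0 ≤ l := log_nonneg (by linarith)
  set s : ℝ := log (max T₀ 1) with hs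
  have hs0 : 0 ≤ s := log_nonneg (le_max_right _ _)
  have hlog2 : 0 < log 2 := log_pos (by norm_num)
  set ε : ℝ := γ * (n - c * (m - 1)) - (c * m - n + 1) with hε
  have hε0 : 0 < ε := by linarith
  obtain ⟨t, htR, hsol⟩ := h (exp (max (((c + 1) * log 2 + N * l) / ε)
    ((log 2 + N * (l + c * s)) / (n * γ - m))))
  have ht0 : 0 < t := (exp_pos _).trans htR
  rw [← lt_log_iff_exp_lt ht0, max_lt_iff, div_lt_iff₀ hε0, div_lt_iff₀ (by linarith)] at htR
  obtain ⟨hτ1, hτ2⟩ := htR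
  set τ : ℝ := log t with hτ
  have htexp : t = exp τ := (exp_log ht0).symm
  rw [multSolvable_iff hn hm _ _ ht0] at hsol
  obtain ⟨x, y, hx, hX, hδ⟩ := hsol
  have hP1 : 1 ≤ ∏ j, max 1 |(x j : ℝ)| :=
    Finset.one_le_prod fun j _ => le_max_left _ _
  set P : ℝ := ∏ j, max 1 |(x j : ℝ)| with hP
  have hP0 : 0 < P := by linarith
  obtain ⟨q, hq⟩ : ∃ q : ℝ, log P = m * q := ⟨log P / m, by field_simp⟩
  have hPexp : P = exp (m * q) := by rw [← hq, exp_log hP0]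
  have hq0 : 0 ≤ q := by
    have := log_nonneg hP1
    rw [hq] at this
    exact nonneg_of_mul_nonneg_right this (by linarith)
  have hqτ : q ≤ τ := by
    rw [hPexp, htexp, ← exp_nat_mul, exp_le_exp] at hX
    exact le_of_mul_le_mul_left hX (by linarith)
  -- With `K = exp (-k)` and `Q = 2 * P * K ^ (1 - m)`, the factor 2 gives Minkowski's strict
  -- inequality, and this `k` makes `t ^ (-γ * n) * Q = K ^ n`.
  obtain ⟨k, hk⟩ : ∃ k : ℝ, N * k = n * γ * τ - m * q - log 2 :=
    ⟨(n * γ * τ - m * q - log 2) / N, by field_simp⟩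
  have hkl : l + c * s < k := by
    refine lt_of_mul_lt_mul_left (a := N) ?_ (by linarith)
    rw [hk]
    nlinarith
  have hcs : 0 ≤ c * s := by positivity
  have hk0 : 0 < k := by linarith
  have hCexp : (n : ℝ) + m = exp l := (exp_log (by linarith)).symm
  have h2exp : (2 : ℝ) = exp (log 2) := (exp_log (by norm_num)).symm
  obtain ⟨u, w, hu0, hu, hw⟩ := exists_transpose_solution Θ x y hx (K := exp (-k))
    (Q := exp (log 2 + m * q + (m - 1) * k)) (exp_pos _)
    (by rw [hCexp, ← exp_add, exp_lt_one_iff]; linarith)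
    (by
      rw [one_le_exp_iff]
      have : 0 ≤ (m - 1 : ℝ) * k := mul_nonneg (by linarith) hk0.le
      positivity)
    (by
      rw [← hP, hPexp, ← exp_add, ← exp_nat_mul, ← exp_add, exp_lt_exp]
      linarith)
    (by
      refine (mul_le_mul_of_nonneg_right hδ (exp_pos _).le).trans ?_
      rw [htexp, ← exp_mul, ← exp_nat_mul, ← exp_nat_mul, ← exp_add, exp_le_exp]
      rw [hN] at hk
      linarith)
  -- `T = exp σ` turns the bound on the forms into an equality; only `Q ≤ T ^ n` and `T₀ < T` then
  -- need `t` large.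
  obtain ⟨σ, hσ⟩ : ∃ σ : ℝ, c * σ = q + k - l := ⟨(q + k - l) / c, by field_simp⟩
  refine ⟨exp σ, ?_, (multSolvable_iff hm hn _ _ (exp_pos _)).2 ⟨u, w, hu0, hu.trans ?_,
    hw.trans ?_⟩⟩
  · refine (le_max_left T₀ 1).trans_lt ?_
    rw [← exp_log (show (0 : ℝ) < max T₀ 1 by positivity), exp_lt_exp]
    refine lt_of_mul_lt_mul_left (a := c) ?_ hc0.le
    rw [hσ]
    linarith
  · rw [← exp_nat_mul, exp_le_exp]
    refine le_of_mul_le_mul_left (a := c * N) ?_ (by positivity)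
    have h1 : c * N * (log 2 + m * q + (m - 1) * k) =
        n * (c * (log 2 + m * q + (m - 1) * γ * τ)) := by
      have : c * N * (log 2 + m * q + (m - 1) * k) =
        c * (N * log 2 + N * m * q + (m - 1) * (N * k)) := by ring
      rw [this, hk, hN]; ring
    have h2 : c * N * (n * σ) = n * ((n - 1) * q + n * γ * τ - log 2 - N * l) := by
      have : c * N * (n * σ) = n * (N * q + N * k - N * l) := by
        linear_combination (N * n) * hσ
      rw [this, hk, hN]; ring
    rw [h1, h2]
    refine mul_le_mul_of_nonneg_left ?_ (by linarith)
    -- The coefficient is positive as `n ≤ c * m`, so the worst case is `q = τ`.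
    have h3 : (c * m - n + 1) * q ≤ (c * m - n + 1) * τ :=
      mul_le_mul_of_nonneg_left hqτ (by linarith)
    rw [hε] at hτ1
    linarith
  · rw [← hP, hPexp, hCexp, ← exp_add, ← exp_nat_mul, ← exp_sub, ← exp_mul, ← exp_nat_mul,
      exp_le_exp]
    have : (m : ℝ) * (σ * -c) = - (m * (c * σ)) := by ring
    rw [this, hσ]
    linarith

theorem theoremt (n m : ℕ) (hn : 1 ≤ n) (hm : 1 ≤ m) (Θ : Matrix (Fin n) (Fin m) ℝ) :
    dysonFraction n m (multExponent Θ) ≤ multExponent Θ.transpose := by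
  have hn1 : (1 : ℝ) ≤ n := by exact_mod_cast hn
  have hm1 : (1 : ℝ) ≤ m := by exact_mod_cast hm
  have hn0 : n ≠ 0 := by omega
  have hm0 : m ≠ 0 := by omega
  refine EReal.ge_of_forall_gt_iff_ge.1 fun c hc => ?_
  rcases lt_or_ge (c : ℝ) (n / m) with hcnm | hcnm
  · refine le_trans ?_ (div_le_multExponent hm0 hn0 Θ.transpose)
    exact_mod_cast hcnm.le
  rw [div_le_iff₀ (by linarith)] at hcnm
  have hlow := div_le_multExponent hn0 hm0 Θ
  -- The Möbius map `ω ↦ (nω + n - 1) / ((m - 1)ω + m)` is inverted at `c`, leaving room for some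
  -- `γ` below the exponent.
  have key : 0 < (n : ℝ) - c * (m - 1) ∧
      (((c * m - n + 1) / (n - c * (m - 1)) : ℝ) : EReal) < multExponent Θ := by
    unfold dysonFraction at hc
    split_ifs at hc with htop h1
    · subst h1
      refine ⟨by norm_num; linarith, ?_⟩
      rw [htop]; exact EReal.coe_lt_top _
    · rw [htop]
      have hm2 : (2 : ℝ) ≤ m := by exact_mod_cast (show 2 ≤ m by omega)
      have hc' : c < n / (m - 1 : ℝ) := by exact_mod_cast hc
      rw [lt_div_iff₀ (by linarith)] at hc'
      exact ⟨by linarith, EReal.coe_lt_top _⟩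
    · have hbot : multExponent Θ ≠ ⊥ := by
        intro hb
        rw [hb, le_bot_iff] at hlow
        exact EReal.coe_ne_bot _ hlow
      lift multExponent Θ to ℝ using ⟨htop, hbot⟩ with ω
      rw [EReal.toReal_coe] at hc
      have hω : (m : ℝ) / n ≤ ω := by exact_mod_cast hlow
      have hω0 : 0 < ω := lt_of_lt_of_le (by positivity) hω
      have hden : 0 < ((m : ℝ) - 1) * ω + m := by
        have : 0 ≤ ((m : ℝ) - 1) * ω := mul_nonneg (by linarith) hω0.le
        linarith
      have hc' : c < ((n : ℝ) * ω + n - 1) / ((m - 1) * ω + m) := by exact_mod_cast hc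
      rw [lt_div_iff₀ hden] at hc'
      have hpos : 0 < (n : ℝ) - c * (m - 1) := by
        by_contra! h0
        nlinarith
      refine ⟨hpos, ?_⟩
      rw [EReal.coe_lt_coe_iff, div_lt_iff₀ hpos]
      linarith
  obtain ⟨hpos, hlt⟩ := key
  obtain ⟨_, ⟨γ, rfl, hγ⟩, hlt⟩ := lt_sSup_iff.1 hlt
  rw [EReal.coe_lt_coe_iff, div_lt_iff₀ hpos] at hlt
  refine le_multExponent_of_frequently fun T₀ =>
    frequently_multSolvable_transpose hn0 hm0 Θ hcnm ?_ hlt hγ T₀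
  have hγ0 : 0 < γ := by
    by_contra! h0
    nlinarith
  -- `m < n * γ` follows by combining `n ≤ c * m` with `c * ((m - 1)γ + m) < nγ + n - 1`.
  by_contra! hle
  have h1 : (n : ℝ) * ((m - 1) * γ + m) ≤ c * m * ((m - 1) * γ + m) :=
    mul_le_mul_of_nonneg_right hcnm (by
      have : 0 ≤ ((m : ℝ) - 1) * γ := mul_nonneg (by linarith) hγ0.le
      linarith)
  nlinarith
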